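/- A Barnette graph is a finite, simple, $3$-regular, $3$-connected, planar, bipartite graph. Let $G$ be a Barnette graph with a planar annular embedding with annuli $A_1,\dots,A_x$. That is, $G$ is embedded in the plane and there are pairwise disjoint cycles $C_0,\dots,C_x$ of $G$, nested in this order from inside to outside and together containing all vertices, such that $C_0$ bounds the interior face, $C_x$ bounds the exterior face, $A_k$ $(1\le k\le x)$ is the region between its inner boundary $C_{k-1}$ and its outer boundary $C_k$, and every edge of $G$ lies on some $C_k$ or lies in the interior of some $A_k$ and joins a vertex of $C_{k-1}$ to a vertex of $C_k$. Assume that $G$ is annular-connected (an ADB-AC graph): $x>2$ and, for every $1\le k\le x$, deleting all edges in the interior of $A_k$ and suppressing their end vertices (which then have degree $2$) leaves inside and outside $A_k$ either two Barnette graphs, or one Barnette graph and one closed curve without vertices. For $1\le j<x$ let the $j$-annular restriction $G_j$ be the part on $C_0,\dots,C_j$ that is left after deleting the edges in the interior of $A_{j+1}$ and suppressing their ends. The faces in its outer annulus $A_j$ can be split into two classes such that no two adjacent faces are in the same class. For $3\le k\le x$, call $A_k$ a block annulus if, for one of the two classes of faces of $A_{k-1}$, all faces in that class are $4$-cycles in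 $G_{k-1}$ and every edge in the interior of $A_k$ is attached to a face of that class (its end on $C_{k-1}$ lies on the boundary of such a face); otherwise call $A_k$ a ring annulus. By convention $A_1$ and $A_2$ have the same type as $A_3$. Suppose that every run $A_i,\dots,A_j$ of consecutive ring annuli lying between two runs of block annuli (that is, $1<i\le j<x$ and $A_{i-1}$, $A_{j+1}$ are block annuli) has length at least $2$. Then $G$ is Hamiltonian. -/

import Mathlib

open SimpleGraph

/-- A combinatorial planar embedding (spherical map) of a connected simple graph: a cyclic
ordering of the darts leaving each vertex (read counterclockwise) for which the face count satisfies
Euler's formula. -/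
structure PlaneEmbedding {V : Type*} (G : SimpleGraph V) where
  connected : G.Connected
  /-- the next dart, counterclockwise, around the tail of a dart -/
  rot : Equiv.Perm G.Dart
  rot_fst : ∀ d, (rot d).fst = d.fst
  rot_sameCycle : ∀ d e : G.Dart, d.fst = e.fst → rot.SameCycle d e
  /-- the faces are the orbits of the map sending `d` to the dart that follows it on the boundary
  of the face on its left -/
  euler : Nat.card V + Nat.card (Quotient (Equiv.Perm.SameCycle.setoid
      ((Function.Involutive.toPerm Dart.symm Dart.symm_involutive).trans rot.symm))) =
    Nat.card G.edgeSet + 2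

namespace PlaneEmbedding

variable {V : Type*} {G : SimpleGraph V}

/-- The dart that follows `d` on the boundary of the face lying to the left of `d`. -/
def facePerm (E : PlaneEmbedding G) : Equiv.Perm G.Dart :=
  (Function.Involutive.toPerm Dart.symm Dart.symm_involutive).trans E.rot.symm

/-- The faces of the embedding. -/
def Face (E : PlaneEmbedding G) : Type _ :=
  Quotient (Equiv.Perm.SameCycle.setoid E.facePerm)

/-- The face lying to the left of a dart. -/
def faceOf (E : PlaneEmbedding G) (d : G.Dart) : E.Face :=
  Quotient.mk (Equiv.Perm.SameCycle.setoid E.facePerm) d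

end PlaneEmbedding

/-- `3`-connectedness: at least four vertices, and deleting at most two of them never
disconnects the graph. -/
def IsThreeConnected {V : Type*} (G : SimpleGraph V) : Prop :=
  4 ≤ Nat.card V ∧ ∀ S : Finset V, S.card ≤ 2 → (G.induce {v | v ∉ S}).Connected

/-- Barnette graphs: finite, cubic, `3`-connected, planar, bipartite simple graphs. -/
structure IsBarnette {V : Type*} (G : SimpleGraph V) : Prop where
  finite : Finite V
  cubic : ∀ v, (G.neighborSet v).ncard = 3
  threeConnected : IsThreeConnected G
  planar : Nonempty (PlaneEmbedding G)
  bipartite : G.IsBipartite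

/-- A planar annular embedding with annuli `A_1, …, A_x`. The boundary curves are disjoint cycles
`C_0, …, C_x` of `G` that together contain all vertices; `C_0` bounds the interior face, `C_x` bounds
the exterior face, and `A_k` is the region between `C_{k-1}` and `C_k`. -/
structure AnnularEmbedding {V : Type*} (G : SimpleGraph V) (x : ℕ) extends PlaneEmbedding G where
  /-- `level v = k` means that `v` lies on the boundary curve `C_k` -/
  level : V → ℕ
  level_le : ∀ v, level v ≤ x
  level_surj : ∀ k ≤ x, ∃ v, level v = k
  /-- the next vertex on the boundary curve through `v`, counterclockwise -/
  next : Equiv.Perm V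
  adj_next : ∀ v, G.Adj v (next v)
  next_next_ne : ∀ v, next (next v) ≠ v
  next_sameCycle : ∀ u v, next.SameCycle u v ↔ level u = level v
  /-- the region on the left of a dart: `0` is the interior face, `x + 1` is the exterior face,
  and `k` with `1 ≤ k ≤ x` is the annulus `A_k` -/
  region : G.Dart → ℕ
  region_facePerm : ∀ d, region (toPlaneEmbedding.facePerm d) = region d
  /-- the annulus `A_k` lies on one side of `C_k` and `A_{k+1}` lies on the other -/
  region_boundary : ∀ d : G.Dart, d.snd = next d.fst →
    region d = level d.fst ∧ region d.symm = level d.fst + 1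
  /-- an edge that is on no boundary curve lies in the interior of an annulus `A_k` and joins the
  inner boundary `C_{k-1}` of `A_k` to its outer boundary `C_k` -/
  region_interior : ∀ d : G.Dart, d.snd ≠ next d.fst → d.fst ≠ next d.snd →
    (level d.fst + 1 = level d.snd ∧ region d = level d.snd ∧ region d.symm = level d.snd) ∨
    (level d.snd + 1 = level d.fst ∧ region d = level d.fst ∧ region d.symm = level d.fst)
  /-- `C_0` is the boundary of a single face -/
  interior_face : ∀ d e, region d = 0 → region e = 0 →
    toPlaneEmbedding.faceOf d = toPlaneEmbedding.faceOf e
  /-- `C_x` is the boundary of a single face -/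
  exterior_face : ∀ d e, region d = x + 1 → region e = x + 1 →
    toPlaneEmbedding.faceOf d = toPlaneEmbedding.faceOf e

/-- Dissolving vertices: the simple graph on the vertex set `K` in which distinct vertices are
adjacent when they are joined in `H` by a walk through no further vertex of `K`. If every vertex
outside `K` has degree `2` in `H`, this replaces each path through vertices outside `K` by one edge
(loops are dropped and parallel edges are merged, which lowers degrees). -/
def dissolve {V : Type*} (H : SimpleGraph V) (K : Set V) : SimpleGraph K :=
  SimpleGraph.fromRel fun a b =>
    ∃ p : H.Walk (a : V) (b : V), ∀ w ∈ p.support, w ∈ K → w = a ∨ w = b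

namespace AnnularEmbedding

variable {V : Type*} {G : SimpleGraph V} {x : ℕ}

/-- The edges in the interior of the annulus `A_k`. -/
def interiorEdges (A : AnnularEmbedding G x) (k : ℕ) : Set (Sym2 V) :=
  {e | e ∈ G.edgeSet ∧ ∃ u v, e = s(u, v) ∧ A.level u + 1 = k ∧ A.level v = k}

/-- The vertices incident with an edge in the interior of `A_k`. -/
def interiorEnds (A : AnnularEmbedding G x) (k : ℕ) : Set V :=
  {v | ∃ e ∈ A.interiorEdges k, v ∈ e}

/-- The vertices left on `C_0, …, C_{k-1}` when the edges in the interior of `A_k` are deleted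
together with their ends. -/
def innerVerts (A : AnnularEmbedding G x) (k : ℕ) : Set V :=
  {v | A.level v < k ∧ v ∉ A.interiorEnds k}

/-- The vertices left on `C_k, …, C_x` when the edges in the interior of `A_k` are deleted
together with their ends. -/
def outerVerts (A : AnnularEmbedding G x) (k : ℕ) : Set V :=
  {v | k ≤ A.level v ∧ v ∉ A.interiorEnds k}

/-- The part inside `A_k` after deleting the edges in the interior of `A_k` and dissolving their
ends. This is the `(k-1)`-annular restriction of `G`. -/
def innerPart (A : AnnularEmbedding G x) (k : ℕ) : SimpleGraph (A.innerVerts k) :=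
  dissolve (G.deleteEdges (A.interiorEdges k)) (A.innerVerts k)

/-- The part outside `A_k` after deleting the edges in the interior of `A_k` and dissolving their
ends. -/
def outerPart (A : AnnularEmbedding G x) (k : ℕ) : SimpleGraph (A.outerVerts k) :=
  dissolve (G.deleteEdges (A.interiorEdges k)) (A.outerVerts k)

/-- Annular-connectedness: there are more than two annuli, and deleting the edges in the interior of
any annulus along with their ends leaves either two Barnette graphs, or one Barnette graph and
a curve without vertices. -/
def IsAnnularConnected (A : AnnularEmbedding G x) : Prop :=
  2 < x ∧ ∀ k, 1 ≤ k → k ≤ x →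
    (IsBarnette (A.innerPart k) ∧ IsBarnette (A.outerPart k)) ∨
    (A.innerVerts k = ∅ ∧ IsBarnette (A.outerPart k)) ∨
    (IsBarnette (A.innerPart k) ∧ A.outerVerts k = ∅)

/-- The length of the face `f` of `G` in the `j`-annular restriction of `G`, for `f` in one of the
annuli `A_1, …, A_j`: the number of its boundary vertices that are vertices of the restriction. -/
noncomputable def restrictedLength (A : AnnularEmbedding G x) (j : ℕ) (f : A.Face) : ℕ :=
  {d : G.Dart | A.faceOf d = f ∧ d.fst ∈ A.innerVerts (j + 1)}.ncard

/-- `P` cuts the faces of `A_j` into two classes, those in `P` and those outside `P`, neither of which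
contains two adjacent faces: each edge in the interior of `A_j` has exactly one side in `P`. -/
def IsFacePartition (A : AnnularEmbedding G x) (j : ℕ) (P : Set A.Face) : Prop :=
  ∀ d : G.Dart, d.edge ∈ A.interiorEdges j → (A.faceOf d ∈ P ↔ A.faceOf d.symm ∉ P)

/-- In the `j`-annular restriction, the faces of its outer annulus `A_j` that belong to `P` are
all `4`-cycles. -/
def IsFourCycleClass (A : AnnularEmbedding G x) (j : ℕ) (P : Set A.Face) : Prop :=
  ∀ d : G.Dart, A.region d = j → A.faceOf d ∈ P → A.restrictedLength j (A.faceOf d) = 4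

/-- The edges in the interior of `A_{j+1}` are attached only to faces of `A_j` in `P`. -/
def AttachedTo (A : AnnularEmbedding G x) (j : ℕ) (P : Set A.Face) : Prop :=
  ∀ d : G.Dart, A.region d = j → A.level d.fst = j → d.fst ∈ A.interiorEnds (j + 1) →
    A.faceOf d ∈ P

/-- `A_{j+1}` is attached to the faces of a class of the face partition of the outer annulus of the
`j`-annular restriction consisting only of `4`-cycles. -/
def IsBlockOver (A : AnnularEmbedding G x) (j : ℕ) : Prop :=
  ∃ P : Set A.Face, A.IsFacePartition j P ∧ A.IsFourCycleClass j P ∧ A.AttachedTo j P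

/-- `A_k` is a block annulus. By convention the first two annuli have the type of the third. -/
def IsBlock (A : AnnularEmbedding G x) (k : ℕ) : Prop :=
  A.IsBlockOver (max k 3 - 1)

/-- An annulus that is not a block annulus is a ring annulus. -/
def IsRing (A : AnnularEmbedding G x) (k : ℕ) : Prop :=
  ¬ A.IsBlock k

/-- Every run `A_i, …, A_j` of ring annuli lying between two runs of block annuli has length at
least `2`. -/
def HasNonsingularRingRuns (A : AnnularEmbedding G x) : Prop :=
  ∀ i j, 2 ≤ i → i ≤ j → j + 1 ≤ x → A.IsBlock (i - 1) → (∀ k, i ≤ k → k ≤ j → A.IsRing k) →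
    A.IsBlock (j + 1) → 2 ≤ j - i + 1

end AnnularEmbedding

/-! Call the edge at a vertex `v` that leaves its boundary curve the rung `μ v`; it leads outwards
or inwards by one level. A Hamiltonian cycle of the part on `C_0, …, C_j` is extended to `C_{j+1}`
by induction on `j`, starting from `C_0`. At the start of an outward rung on `C_j` such a cycle must
use both curve edges, so an edge joining two such starts can be replaced by a detour along the two
rungs and part of `C_{j+1}`.

Two facts show that suitable edges exist. By Euler's formula there are two more faces than rungs, so
each face inside an annulus lies to the left of exactly one outward rung; hence the rungs of an
annulus meet its two curves in the same cyclic order (`firstHit_rung`). Fix a two-colouring of `G`.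
Comparing it with a two-colouring of the bipartite outer part shows that consecutive outward rungs
on a curve start at different colours (`color_ne_of_firstHit_outward`), and by the cyclic order the
same holds for inward ones.

A parity invariant then shows that on each curve all vertices followed by a change of direction have
one colour (`exists_color_switch`). Vertices of the other colour are followed by a vertex of the
same direction. So the outward starts on `C_j` pair off into curve edges whose first vertices share
a colour, and likewise the inward starts on `C_{j+1}`. If the two colours agree, a detour is made at
every pair (`extend_alternating`). If they differ, some pair on `C_j` lies opposite a pair on
`C_{j+1}`, and one detour runs once around `C_{j+1}` (`extend_around`). -/

/-! ### First hits along an orbit -/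

/-- `w` is the first point with property `p` on the forward orbit of `v` under `f`, `v` included. -/
inductive FirstHit {V : Type*} (f : V → V) (p : V → Prop) : V → V → Prop
  | here {v : V} : p v → FirstHit f p v v
  | step {v w : V} : ¬ p v → FirstHit f p (f v) w → FirstHit f p v w

namespace FirstHit

variable {V : Type*} {f : V → V} {p : V → Prop}

theorem prop {v w : V} (h : FirstHit f p v w) : p w := by
  induction h with
  | here h => exact h
  | step _ _ ih => exact ih

theorem unique {v w w' : V} (h : FirstHit f p v w) (h' : FirstHit f p v w') : w = w' := by
  induction h with
  | here h => cases h' with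
    | here _ => rfl
    | step hn _ => exact absurd h hn
  | step hn _ ih => cases h' with
    | here h => exact absurd h hn
    | step _ h => exact ih h

theorem exists_of_iterate (n : ℕ) {v : V} (h : p (f^[n] v)) : ∃ w, FirstHit f p v w := by
  induction n generalizing v with
  | zero => exact ⟨v, here h⟩
  | succ n ih =>
    by_cases hv : p v
    · exact ⟨v, here hv⟩
    · obtain ⟨w, hw⟩ := ih (v := f v) (by simpa [Function.iterate_succ_apply] using h)
      exact ⟨w, step hv hw⟩

theorem exists_of_sameCycle [Finite V] {f : Equiv.Perm V} {v w : V} (h : f.SameCycle v w)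
    (hw : p w) : ∃ z, FirstHit f p v z := by
  obtain ⟨n, hn⟩ := h.exists_nat_pow_eq
  refine exists_of_iterate n ?_
  rwa [Equiv.Perm.iterate_eq_pow, hn]

theorem sameCycle {f : Equiv.Perm V} {v w : V} (h : FirstHit f p v w) : f.SameCycle v w := by
  induction h with
  | here h => exact Equiv.Perm.SameCycle.refl _ _
  | step _ _ ih => exact Equiv.Perm.sameCycle_apply_left.1 ih

/-- Running backwards to the previous point with property `p` and then forwards again. -/
theorem of_symm {f : Equiv.Perm V} {v a w : V} (h : FirstHit f.symm p v a)
    (h' : FirstHit f p (f v) w) : FirstHit f p (f a) w := by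
  induction h with
  | here h => exact h'
  | step hn _ ih => exact ih (by simpa using step hn h')

theorem exists_prev [Finite V] (f : Equiv.Perm V) {w : V} (hw : p w) :
    ∃ v, p v ∧ FirstHit f p (f v) w := by
  obtain ⟨v, hv⟩ : ∃ v, FirstHit f.symm p (f.symm w) v :=
    exists_of_sameCycle (f := f.symm) (w := w)
      (by simpa using Equiv.Perm.SameCycle.refl f.symm w) hw
  exact ⟨v, hv.prop, hv.of_symm (by simpa using here hw)⟩

end FirstHit

/-! ### Rungs and their directions -/

namespace AnnularEmbedding

variable {V : Type*} {G : SimpleGraph V} {x : ℕ}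

/-- `μ v` is the neighbour of `v` that is not a neighbour of `v` on its boundary curve. -/
structure IsRung (A : AnnularEmbedding G x) (μ : V → V) : Prop where
  adj : ∀ v, G.Adj v (μ v)
  ne_next : ∀ v, μ v ≠ A.next v
  next_ne : ∀ v, A.next (μ v) ≠ v
  eq_of_adj : ∀ v w, G.Adj v w → w = A.next v ∨ A.next w = v ∨ w = μ v

theorem exists_isRung (A : AnnularEmbedding G x) (hc : ∀ v, (G.neighborSet v).ncard = 3) :
    ∃ μ, A.IsRung μ := by
  have key : ∀ v, ∃ u, G.Adj v u ∧ u ≠ A.next v ∧ A.next u ≠ v ∧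
      ∀ w, G.Adj v w → w = A.next v ∨ A.next w = v ∨ w = u := by
    intro v
    obtain ⟨a, b, c, hab, hac, hbc, h⟩ := Set.ncard_eq_three.1 (hc v)
    have hmem : ∀ w, G.Adj v w ↔ w = a ∨ w = b ∨ w = c := fun w => by
      rw [← mem_neighborSet, h]; simp
    -- The curve neighbours of `next p` are `p` and `next (next p)`, which differ; the rung leads to
    -- the remaining one of `a`, `b`, `c`.
    obtain ⟨p, rfl⟩ := A.next.surjective v
    have h1 := (hmem _).1 (A.adj_next (A.next p))
    have h2 := (hmem p).1 (A.adj_next p).symm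
    have h3 := A.next_next_ne p
    have h4 : ∀ u, A.next u = A.next p ↔ u = p := fun u => A.next.injective.eq_iff
    simp only [h4, hmem]
    clear h hmem
    rcases h1 with e | e | e <;> rcases h2 with e' | e' | e' <;>
      first
      | exact absurd (e.trans e'.symm) h3
      | exact ⟨a, by grind⟩
      | exact ⟨b, by grind⟩
      | exact ⟨c, by grind⟩
  choose μ h using key
  exact ⟨μ, fun v => (h v).1, fun v => (h v).2.1, fun v => (h v).2.2.1, fun v => (h v).2.2.2⟩

theorem level_next (A : AnnularEmbedding G x) (v : V) : A.level (A.next v) = A.level v :=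
  ((A.next_sameCycle _ _).1 (by simpa using Equiv.Perm.SameCycle.refl A.next v)).symm

theorem level_next_symm (A : AnnularEmbedding G x) (v : V) :
    A.level (A.next.symm v) = A.level v := by
  simpa using (A.level_next (A.next.symm v)).symm

/-- The rung at `v` leads to the next boundary curve further out. -/
def Outward (A : AnnularEmbedding G x) (μ : V → V) (v : V) : Prop :=
  A.level (μ v) = A.level v + 1

/-- The rung at `v` leads to the next boundary curve further in. -/
def Inward (A : AnnularEmbedding G x) (μ : V → V) (v : V) : Prop :=
  A.level (μ v) + 1 = A.level v

namespace IsRung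

variable {A : AnnularEmbedding G x} {μ : V → V}

theorem invol (h : A.IsRung μ) (v : V) : μ (μ v) = v := by
  have h1 := h.eq_of_adj (μ v) v (h.adj v).symm
  have h2 := h.next_ne v
  have h3 := h.ne_next v
  grind

theorem outward_or_inward (h : A.IsRung μ) (v : V) : A.Outward μ v ∨ A.Inward μ v := by
  have := A.region_interior ⟨(v, μ v), h.adj v⟩ (h.ne_next v) (h.next_ne v).symm
  simp only [Outward, Inward] at *
  omega

theorem inward_iff (h : A.IsRung μ) (v : V) : A.Inward μ v ↔ ¬ A.Outward μ v := by
  have := h.outward_or_inward v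
  simp only [Outward, Inward] at *
  omega

theorem outward_rung (h : A.IsRung μ) (v : V) : A.Outward μ (μ v) ↔ A.Inward μ v := by
  simp only [Outward, Inward, h.invol]
  omega

theorem inward_rung (h : A.IsRung μ) (v : V) : A.Inward μ (μ v) ↔ A.Outward μ v := by
  simp only [Outward, Inward, h.invol]
  omega

theorem outward_of_level_eq_zero (h : A.IsRung μ) {v : V} (hv : A.level v = 0) :
    A.Outward μ v := by
  have := h.outward_or_inward v
  simp only [Outward, Inward] at *
  omega

theorem level_lt_of_outward {v : V} (hv : A.Outward μ v) : A.level v < x := by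
  have := A.level_le (μ v)
  simp only [Outward] at *
  omega

/-- An edge leading outwards across a boundary curve is a rung. -/
theorem eq_rung_of_level_lt (h : A.IsRung μ) {v w : V} (hvw : G.Adj v w)
    (hl : A.level v < A.level w) : w = μ v ∧ A.Outward μ v := by
  have h1 := A.level_next v
  have h2 := A.level_next w
  have h3 := h.outward_or_inward v
  simp only [Outward, Inward] at *
  obtain e | e | rfl := h.eq_of_adj v w hvw
  · subst e; omega
  · rw [e] at h2; omega
  · exact ⟨rfl, by omega⟩

/-- A path from `C_0` to `C_x` must rise above level `k` somewhere, and only rungs change the level.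
-/
theorem exists_outward (h : A.IsRung μ) {k : ℕ} (hk : k < x) :
    ∃ v, A.level v = k ∧ A.Outward μ v := by
  obtain ⟨a, ha⟩ := A.level_surj 0 (Nat.zero_le _)
  obtain ⟨b, hb⟩ := A.level_surj x le_rfl
  obtain ⟨p⟩ := A.connected.preconnected a b
  obtain ⟨d, -, h1, h2⟩ := p.exists_boundary_dart {v | A.level v ≤ k}
    (by simp [ha]) (by simpa [hb] using hk)
  simp only [Set.mem_ofPred_eq, not_le] at h1 h2
  obtain ⟨e, ho⟩ := h.eq_rung_of_level_lt d.adj (by omega)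
  rw [e] at h2
  exact ⟨d.fst, by simp only [Outward] at ho; omega, ho⟩

theorem exists_inward (h : A.IsRung μ) {k : ℕ} (hk : 1 ≤ k) (hkx : k ≤ x) :
    ∃ v, A.level v = k ∧ A.Inward μ v := by
  obtain ⟨v, hv, ho⟩ := h.exists_outward (k := k - 1) (by omega)
  exact ⟨μ v, by simp only [Outward] at ho; omega, (h.inward_rung v).2 ho⟩

theorem exists_firstHit_outward [Finite V] (h : A.IsRung μ) {v : V} (hv : A.level v < x) :
    ∃ w, FirstHit A.next (A.Outward μ) v w := by
  obtain ⟨w, hw, ho⟩ := h.exists_outward hv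
  exact FirstHit.exists_of_sameCycle ((A.next_sameCycle _ _).2 hw.symm) ho

theorem exists_firstHit_symm_outward [Finite V] (h : A.IsRung μ) {v : V} (hv : A.level v < x) :
    ∃ w, FirstHit A.next.symm (A.Outward μ) v w := by
  obtain ⟨w, hw, ho⟩ := h.exists_outward hv
  exact FirstHit.exists_of_sameCycle
    (Equiv.Perm.sameCycle_inv.2 ((A.next_sameCycle _ _).2 hw.symm)) ho

theorem exists_firstHit_inward [Finite V] (h : A.IsRung μ) {v : V} (hv : 1 ≤ A.level v) :
    ∃ w, FirstHit A.next (A.Inward μ) v w := by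
  obtain ⟨w, hw, ho⟩ := h.exists_inward hv (A.level_le v)
  exact FirstHit.exists_of_sameCycle ((A.next_sameCycle _ _).2 hw.symm) ho

end IsRung

theorem level_eq_of_firstHit {A : AnnularEmbedding G x} {p : V → Prop} {v w : V}
    (h : FirstHit A.next p v w) : A.level w = A.level v :=
  ((A.next_sameCycle _ _).1 h.sameCycle).symm

end AnnularEmbedding

/-! ### Tracing face boundaries -/

namespace PlaneEmbedding

variable {V : Type*} {G : SimpleGraph V} (E : PlaneEmbedding G)

theorem facePerm_apply (d : G.Dart) : E.facePerm d = E.rot.symm d.symm := rfl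

theorem facePerm_fst (d : G.Dart) : (E.facePerm d).fst = d.snd := by
  have := E.rot_fst (E.rot.symm d.symm)
  rw [Equiv.apply_symm_apply] at this
  exact this.symm

theorem faceOf_eq_iff {d e : G.Dart} : E.faceOf d = E.faceOf e ↔ E.facePerm.SameCycle d e :=
  Quotient.eq

theorem faceOf_facePerm (d : G.Dart) : E.faceOf (E.facePerm d) = E.faceOf d :=
  E.faceOf_eq_iff.2 (Equiv.Perm.sameCycle_apply_left.2 (Equiv.Perm.SameCycle.refl _ _))

/-- A face boundary turns back only at a vertex of degree one. -/
theorem facePerm_ne_symm {d e : G.Dart} (he : e.fst = d.snd) (hne : e ≠ d.symm) :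
    E.facePerm d ≠ d.symm := by
  intro h
  -- Turning back makes `d.symm` a fixed point of `rot`, hence the only dart at its tail, contrary
  -- to the existence of `e`.
  have hfix : E.rot d.symm = d.symm := by
    rw [facePerm_apply, Equiv.symm_apply_eq] at h
    exact h.symm
  exact hne (((E.rot_sameCycle d.symm e he.symm).eq_of_left hfix).symm)

end PlaneEmbedding

namespace AnnularEmbedding

variable {V : Type*} {G : SimpleGraph V} {x : ℕ}

/-- The dart from `v` to the next vertex on its boundary curve. -/
def fwd (A : AnnularEmbedding G x) (v : V) : G.Dart := ⟨(v, A.next v), A.adj_next v⟩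

/-- The dart from `v` to the previous vertex on its boundary curve. -/
def bwd (A : AnnularEmbedding G x) (v : V) : G.Dart :=
  ⟨(v, A.next.symm v), by simpa using (A.adj_next (A.next.symm v)).symm⟩

theorem region_fwd (A : AnnularEmbedding G x) (v : V) : A.region (A.fwd v) = A.level v :=
  (A.region_boundary (A.fwd v) rfl).1

theorem fwd_symm (A : AnnularEmbedding G x) (v : V) : (A.fwd v).symm = A.bwd (A.next v) := by
  ext <;> simp [fwd, bwd]

theorem region_bwd (A : AnnularEmbedding G x) (v : V) : A.region (A.bwd v) = A.level v + 1 := by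
  obtain ⟨u, rfl⟩ := A.next.surjective v
  rw [← fwd_symm, (A.region_boundary (A.fwd u) rfl).2, level_next]
  rfl

namespace IsRung

variable {A : AnnularEmbedding G x} {μ : V → V}

/-- The dart from `v` along its rung. -/
def dart (h : A.IsRung μ) (v : V) : G.Dart := ⟨(v, μ v), h.adj v⟩

theorem dart_symm (h : A.IsRung μ) (v : V) : (h.dart v).symm = h.dart (μ v) := by
  ext <;> simp [dart, h.invol]

theorem region_dart_outward (h : A.IsRung μ) {v : V} (hv : A.Outward μ v) :
    A.region (h.dart v) = A.level v + 1 := by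
  have := A.region_interior (h.dart v) (h.ne_next v) (h.next_ne v).symm
  simp only [Outward, dart] at *
  omega

theorem region_dart_inward (h : A.IsRung μ) {v : V} (hv : A.Inward μ v) :
    A.region (h.dart v) = A.level v := by
  have := A.region_interior (h.dart v) (h.ne_next v) (h.next_ne v).symm
  simp only [Inward, dart] at *
  omega

theorem eq_of_dart (h : A.IsRung μ) (d : G.Dart) :
    d = A.fwd d.fst ∨ d = A.bwd d.fst ∨ d = h.dart d.fst := by
  obtain ⟨⟨v, w⟩, hvw⟩ := d
  obtain e | e | e := h.eq_of_adj v w hvw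
  · left; ext <;> simp [fwd, e]
  · right; left; ext <;> simp [bwd, ← e]
  · right; right; ext <;> simp [dart, e]

theorem fwd_ne_dart (h : A.IsRung μ) (v w : V) : A.fwd v ≠ h.dart w := by
  intro e
  have h1 : v = w := congrArg (fun d : G.Dart => d.fst) e
  have h2 : A.next v = μ w := congrArg (fun d : G.Dart => d.snd) e
  exact h.ne_next v (by rw [h2, h1])

theorem facePerm_cases (h : A.IsRung μ) (d : G.Dart) :
    A.facePerm d = A.fwd d.snd ∨ A.facePerm d = A.bwd d.snd ∨ A.facePerm d = h.dart d.snd := by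
  have := h.eq_of_dart (A.facePerm d)
  rwa [A.facePerm_fst] at this

theorem facePerm_dart_ne (h : A.IsRung μ) (v : V) :
    A.facePerm (h.dart v) ≠ h.dart (μ v) := by
  rw [← dart_symm]
  refine A.facePerm_ne_symm (e := A.fwd (μ v)) rfl ?_
  rw [dart_symm]
  exact h.fwd_ne_dart _ _

/-- The region on the left is constant along a face, and of the three darts at the head only one has
the right region. The same argument, with turning back excluded where needed, settles the other
cases. -/
theorem facePerm_fwd_outward (h : A.IsRung μ) {v : V} (hv : A.Outward μ (A.next v)) :
    A.facePerm (A.fwd v) = A.fwd (A.next v) := by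
  have hr := A.region_facePerm (A.fwd v)
  rw [region_fwd] at hr
  have hl := A.level_next v
  obtain e | e | e := h.facePerm_cases (A.fwd v)
  · exact e
  · rw [e, region_bwd] at hr
    simp only [fwd] at hr
    omega
  · rw [e, h.region_dart_outward (by exact hv)] at hr
    simp only [fwd] at hr
    omega

theorem facePerm_dart_outward (h : A.IsRung μ) {v : V} (hv : A.Outward μ v) :
    A.facePerm (h.dart v) = A.fwd (μ v) := by
  have hr := A.region_facePerm (h.dart v)
  rw [h.region_dart_outward hv] at hr
  obtain e | e | e := h.facePerm_cases (h.dart v)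
  · exact e
  · rw [e, region_bwd] at hr
    simp only [dart, Outward] at hr hv
    omega
  · exact absurd e (h.facePerm_dart_ne v)

theorem facePerm_dart_inward (h : A.IsRung μ) {v : V} (hv : A.Inward μ v) :
    A.facePerm (h.dart v) = A.bwd (μ v) := by
  have hr := A.region_facePerm (h.dart v)
  rw [h.region_dart_inward hv] at hr
  obtain e | e | e := h.facePerm_cases (h.dart v)
  · rw [e, region_fwd] at hr
    simp only [dart, Inward] at hr hv
    omega
  · exact e
  · exact absurd e (h.facePerm_dart_ne v)

theorem facePerm_fwd_inward (h : A.IsRung μ) {v : V} (hv : A.Inward μ (A.next v)) :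
    A.facePerm (A.fwd v) = h.dart (A.next v) := by
  have hr := A.region_facePerm (A.fwd v)
  rw [region_fwd] at hr
  have hl := A.level_next v
  obtain e | e | e := h.facePerm_cases (A.fwd v)
  -- Here the region does not separate `fwd` from the rung. But `fwd (next v)` already follows the
  -- dart that arrives along the rung, and `facePerm` is injective.
  · have e' := h.facePerm_dart_outward ((h.outward_rung _).2 hv)
    rw [h.invol] at e'
    exact absurd (A.facePerm.injective (e.trans e'.symm)) (h.fwd_ne_dart _ _)
  · rw [e, region_bwd] at hr
    simp only [fwd] at hr
    omega
  · exact e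

theorem bwd_ne_dart (h : A.IsRung μ) (v w : V) : A.bwd v ≠ h.dart w := by
  intro e
  have h1 : v = w := congrArg (fun d : G.Dart => d.fst) e
  have h2 : A.next.symm v = μ w := congrArg (fun d : G.Dart => d.snd) e
  exact h.next_ne v (by rw [h1, ← h2, Equiv.apply_symm_apply, h1])

theorem facePerm_bwd_inward (h : A.IsRung μ) {v : V} (hv : A.Inward μ (A.next.symm v)) :
    A.facePerm (A.bwd v) = A.bwd (A.next.symm v) := by
  have hr := A.region_facePerm (A.bwd v)
  rw [region_bwd] at hr
  have hl := A.level_next_symm v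
  obtain e | e | e := h.facePerm_cases (A.bwd v)
  · rw [e, region_fwd] at hr
    simp only [bwd] at hr
    omega
  · exact e
  · rw [e, h.region_dart_inward (by exact hv)] at hr
    simp only [bwd] at hr
    omega

theorem facePerm_bwd_outward (h : A.IsRung μ) {v : V} (hv : A.Outward μ (A.next.symm v)) :
    A.facePerm (A.bwd v) = h.dart (A.next.symm v) := by
  have hr := A.region_facePerm (A.bwd v)
  rw [region_bwd] at hr
  have hl := A.level_next_symm v
  obtain e | e | e := h.facePerm_cases (A.bwd v)
  · rw [e, region_fwd] at hr
    simp only [bwd] at hr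
    omega
  · have e' := h.facePerm_dart_inward ((h.inward_rung _).2 hv)
    rw [h.invol] at e'
    exact absurd (A.facePerm.injective (e.trans e'.symm)) (h.bwd_ne_dart _ _)
  · exact e

/-- The face to the left of an edge of a boundary curve contains the next rung leading inwards. -/
theorem faceOf_fwd (h : A.IsRung μ) {v w : V} (hw : FirstHit A.next (A.Inward μ) (A.next v) w) :
    A.faceOf (A.fwd v) = A.faceOf (A.bwd (μ w)) := by
  generalize hu : A.next v = u at hw
  induction hw generalizing v with
  | here hi =>
    subst hu
    rw [← A.faceOf_facePerm, h.facePerm_fwd_inward hi, ← A.faceOf_facePerm,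
      h.facePerm_dart_inward hi]
  | step hn _ ih =>
    subst hu
    rw [h.inward_iff, not_not] at hn
    rw [← A.faceOf_facePerm, h.facePerm_fwd_outward hn, ih rfl]

/-- The face to the right of an edge of a boundary curve contains the previous rung leading
outwards. -/
theorem faceOf_bwd (h : A.IsRung μ) {v w : V}
    (hw : FirstHit A.next.symm (A.Outward μ) (A.next.symm v) w) :
    A.faceOf (A.bwd v) = A.faceOf (h.dart w) := by
  generalize hu : A.next.symm v = u at hw
  induction hw generalizing v with
  | here hi =>
    subst hu
    rw [← A.faceOf_facePerm, h.facePerm_bwd_outward hi]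
  | step hn _ ih =>
    subst hu
    rw [← h.inward_iff] at hn
    rw [← A.faceOf_facePerm, h.facePerm_bwd_inward hn, ih rfl]

end IsRung

end AnnularEmbedding

/-! ### Euler's formula and the cyclic order of rungs -/

theorem SimpleGraph.two_mul_card_edgeSet_of_cubic {V : Type*} [Finite V] {G : SimpleGraph V}
    (hc : ∀ v, (G.neighborSet v).ncard = 3) : 2 * Nat.card G.edgeSet = 3 * Nat.card V := by
  classical
  have := Fintype.ofFinite V
  have h := G.sum_degrees_eq_twice_card_edges
  have hd : ∀ v, G.degree v = 3 := fun v => by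
    rw [← hc v, Set.ncard_eq_toFinset_card', ← card_neighborFinset_eq_degree]
    rfl
  simp only [hd, Finset.sum_const, Finset.card_univ, smul_eq_mul] at h
  rw [Nat.card_eq_fintype_card, Nat.card_eq_fintype_card, ← edgeFinset_card, ← h, mul_comm]

namespace AnnularEmbedding.IsRung

variable {V : Type*} {G : SimpleGraph V} {x : ℕ} {A : AnnularEmbedding G x} {μ : V → V}

/-- The involution `μ` exchanges outward and inward vertices. -/
theorem card_eq_two_mul_card_outward [Finite V] (h : A.IsRung μ) :
    Nat.card V = 2 * Nat.card {v // A.Outward μ v} := by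
  classical
  have e : {v // A.Outward μ v} ≃ {v // ¬ A.Outward μ v} :=
    { toFun := fun v => ⟨μ v, by rw [h.outward_rung, h.inward_iff, not_not]; exact v.2⟩
      invFun := fun v => ⟨μ v, by rw [h.outward_rung, h.inward_iff]; exact v.2⟩
      left_inv := fun v => Subtype.ext (h.invol _)
      right_inv := fun v => Subtype.ext (h.invol _) }
  rw [← Nat.card_congr (Equiv.sumCompl (A.Outward μ)), Nat.card_sum, ← Nat.card_congr e, two_mul]

/-- By Euler's formula there are two more faces than rungs. -/
theorem card_face [Finite V] (h : A.IsRung μ) (hc : ∀ v, (G.neighborSet v).ncard = 3) :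
    Nat.card A.Face = Nat.card {v // A.Outward μ v} + 2 := by
  have h1 := SimpleGraph.two_mul_card_edgeSet_of_cubic hc
  have h2 := h.card_eq_two_mul_card_outward
  have h3 : Nat.card V + Nat.card A.Face = Nat.card G.edgeSet + 2 := A.euler
  -- With `n` outward vertices there are `2n` vertices and `3n` edges, so `n + 2` faces.
  omega

theorem exists_faceOf_bwd [Finite V] (h : A.IsRung μ) (v : V) :
    A.region (A.bwd v) = x + 1 ∨ ∃ w, A.Outward μ w ∧ A.faceOf (A.bwd v) = A.faceOf (h.dart w) := by
  rw [region_bwd]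
  rcases (A.level_le v).eq_or_lt with e | e
  · exact Or.inl (by omega)
  · rw [← A.level_next_symm] at e
    obtain ⟨w, hw⟩ := h.exists_firstHit_symm_outward e
    exact Or.inr ⟨w, hw.prop, h.faceOf_bwd hw⟩

/-- Every face other than the interior and the exterior one has a rung leading outwards on its
boundary. -/
theorem exists_faceOf [Finite V] (h : A.IsRung μ) (d : G.Dart) :
    (∃ e, A.region e = 0 ∧ A.faceOf d = A.faceOf e) ∨
    (∃ e, A.region e = x + 1 ∧ A.faceOf d = A.faceOf e) ∨
    ∃ w, A.Outward μ w ∧ A.faceOf d = A.faceOf (h.dart w) := by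
  have hb : ∀ {v}, A.faceOf d = A.faceOf (A.bwd v) →
      (∃ e, A.region e = x + 1 ∧ A.faceOf d = A.faceOf e) ∨
      ∃ w, A.Outward μ w ∧ A.faceOf d = A.faceOf (h.dart w) := fun {v} hv => by
    obtain e | ⟨w, hw, e⟩ := h.exists_faceOf_bwd v
    · exact Or.inl ⟨_, e, hv⟩
    · exact Or.inr ⟨w, hw, hv.trans e⟩
  obtain e | e | e := h.eq_of_dart d
  · rcases Nat.eq_zero_or_pos (A.level d.fst) with hl | hl
    · refine Or.inl ⟨A.fwd d.fst, ?_, by rw [← e]⟩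
      rw [region_fwd, hl]
    · rw [← A.level_next] at hl
      obtain ⟨w, hw⟩ := h.exists_firstHit_inward hl
      exact Or.inr (hb ((congrArg A.faceOf e).trans (h.faceOf_fwd hw)))
  · exact Or.inr (hb (congrArg A.faceOf e))
  · obtain ho | hi := h.outward_or_inward d.fst
    · exact Or.inr (Or.inr ⟨d.fst, ho, congrArg A.faceOf e⟩)
    · refine Or.inr (hb (v := μ d.fst) ?_)
      rw [← h.facePerm_dart_inward hi, A.faceOf_facePerm, ← e]

/-- Each face has at most one rung leading outwards on its boundary. -/
theorem faceOf_dart_injective [Finite V] (h : A.IsRung μ)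
    (hc : ∀ v, (G.neighborSet v).ncard = 3) {v w : V} (hv : A.Outward μ v) (hw : A.Outward μ w)
    (e : A.faceOf (h.dart v) = A.faceOf (h.dart w)) : v = w := by
  obtain ⟨a, ha⟩ := A.level_surj 0 (Nat.zero_le _)
  obtain ⟨b, hb⟩ := A.level_surj x le_rfl
  -- The two extra points stand for the interior and the exterior face. A surjection between finite
  -- sets of equal size is injective.
  let φ : Option (Option {v // A.Outward μ v}) → A.Face := fun o =>
    o.elim (A.faceOf (A.fwd a)) fun o => o.elim (A.faceOf (A.bwd b)) fun v => A.faceOf (h.dart v)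
  have hφ : Function.Surjective φ := by
    intro f
    obtain ⟨d, rfl⟩ := Quotient.exists_rep f
    change ∃ o, φ o = A.faceOf d
    obtain ⟨e, he, hd⟩ | ⟨e, he, hd⟩ | ⟨w, hw, hd⟩ := h.exists_faceOf d
    · exact ⟨none, hd ▸ A.interior_face _ _ (by rw [region_fwd, ha]) he⟩
    · exact ⟨some none, hd ▸ A.exterior_face _ _ (by rw [region_bwd, hb]) he⟩
    · exact ⟨some (some ⟨w, hw⟩), hd.symm⟩
  have hinj := (hφ.bijective_of_nat_card_le (by
    rw [h.card_face hc, Finite.card_option, Finite.card_option])).1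
  have := @hinj (some (some ⟨v, hv⟩)) (some (some ⟨w, hw⟩)) e
  simpa using this

/-- The rungs of an annulus meet its two boundary curves in the same cyclic order. -/
theorem firstHit_rung [Finite V] (h : A.IsRung μ) (hc : ∀ v, (G.neighborSet v).ncard = 3)
    {a b : V} (ha : A.Outward μ a) (hb : FirstHit A.next (A.Inward μ) (A.next (μ a)) b) :
    FirstHit A.next (A.Outward μ) (A.next a) (μ b) := by
  have hbo : A.Outward μ (μ b) := (h.outward_rung b).2 hb.prop
  -- The face left of the rung at `a` follows the outer curve to `b`, returns along the rung of `b`,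
  -- and runs backwards to the previous outward vertex `w`. It lies left of the rungs at `a` and
  -- `w`, so `w = a`.
  obtain ⟨w, hw⟩ := h.exists_firstHit_symm_outward
    (v := A.next.symm (μ b)) (by rw [level_next_symm]; exact level_lt_of_outward hbo)
  have e : A.faceOf (h.dart a) = A.faceOf (h.dart w) := by
    rw [← A.faceOf_facePerm, h.facePerm_dart_outward ha, h.faceOf_fwd hb, h.faceOf_bwd hw]
  obtain rfl := h.faceOf_dart_injective hc ha hw.prop e
  exact hw.of_symm (by simpa using FirstHit.here hbo)

end AnnularEmbedding.IsRung

/-! ### Colours of consecutive rungs -/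

theorem SimpleGraph.IsBipartite.exists_bool {V : Type*} {G : SimpleGraph V} (h : G.IsBipartite) :
    ∃ c : V → Bool, ∀ u v, G.Adj u v → c u ≠ c v := by
  obtain ⟨C⟩ := h
  refine ⟨fun v => decide (C v = 0), fun u v huv => ?_⟩
  have := C.valid huv
  rw [Ne, decide_eq_decide]
  omega

namespace AnnularEmbedding

variable {V : Type*} {G : SimpleGraph V} {x : ℕ} {A : AnnularEmbedding G x} {μ : V → V}

theorem not_mem_interiorEdges_of_level {A : AnnularEmbedding G x} {k : ℕ} {u v : V}
    (hu : k ≤ A.level u) (hv : k ≤ A.level v) : s(u, v) ∉ A.interiorEdges k := by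
  rintro ⟨-, a, b, e, ha, hb⟩
  rcases Sym2.eq_iff.1 e with ⟨rfl, rfl⟩ | ⟨rfl, rfl⟩ <;> omega

/-- A two-colouring of the part outside `A_k`, read on all vertices. -/
theorem exists_coloring_outerPart {k : ℕ} (h : (A.outerPart k).IsBipartite) :
    ∃ c : V → Bool, ∀ u v, u ∈ A.outerVerts k → v ∈ A.outerVerts k → u ≠ v →
      (∃ p : (G.deleteEdges (A.interiorEdges k)).Walk u v,
        ∀ w ∈ p.support, w ∈ A.outerVerts k → w = u ∨ w = v) → c u ≠ c v := by
  classical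
  obtain ⟨c, hc⟩ := h.exists_bool
  refine ⟨fun v => if h : v ∈ A.outerVerts k then c ⟨v, h⟩ else true, ?_⟩
  intro u v hu hv huv hp
  simp only [hu, hv, dif_pos]
  exact hc ⟨u, hu⟩ ⟨v, hv⟩ ⟨by simpa using huv, Or.inl hp⟩

/-- Two colourings that both alternate along a boundary curve agree up to exchanging the colours. -/
theorem beq_of_firstHit {c c' : V → Bool} {p : V → Prop} {v w : V}
    (h : FirstHit A.next p v w)
    (hc : ∀ u, A.level u = A.level v → c u ≠ c (A.next u))
    (hc' : ∀ u, A.level u = A.level v → c' u ≠ c' (A.next u)) :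
    (c v == c' v) = (c w == c' w) := by
  induction h with
  | here _ => rfl
  | step _ _ ih =>
    rename_i v w _ _
    rw [← ih (by rwa [level_next]) (by rwa [level_next])]
    have h1 := hc v rfl
    have h2 := hc' v rfl
    revert h1 h2
    cases c v <;> cases c' v <;> cases c (A.next v) <;> cases c' (A.next v) <;> simp

namespace IsRung

theorem mem_interiorEnds_of_inward (h : A.IsRung μ) {v : V} (hv : A.Inward μ v) :
    v ∈ A.interiorEnds (A.level v) :=
  ⟨s(μ v, v), ⟨(h.adj v).symm, μ v, v, rfl, hv, rfl⟩, Sym2.mem_mk_right _ _⟩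

theorem mem_outerVerts_of_outward (h : A.IsRung μ) {v : V} (hv : A.Outward μ v) :
    v ∈ A.outerVerts (A.level v) := by
  refine ⟨le_rfl, ?_⟩
  rintro ⟨_, ⟨he, a, b, rfl, ha, hb⟩, hm⟩
  rcases Sym2.mem_iff.1 hm with rfl | rfl
  · omega
  · obtain ⟨e, ho⟩ := h.eq_rung_of_level_lt (v := a) (w := v) he (by omega)
    subst e
    have := (h.inward_rung a).2 ho
    rw [h.inward_iff] at this
    exact this hv

theorem mem_outerVerts_of_lt {k : ℕ} {v : V} (hv : k < A.level v) :
    v ∈ A.outerVerts k := by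
  refine ⟨hv.le, ?_⟩
  rintro ⟨_, ⟨he, a, b, rfl, ha, hb⟩, hm⟩
  rcases Sym2.mem_iff.1 hm with rfl | rfl <;> omega

/-- The path along a boundary curve to the next rung leading outwards. -/
theorem exists_walk {k : ℕ} {v w : V} (hv : A.level v = k)
    (hw : FirstHit A.next (A.Outward μ) v w) :
    ∃ p : (G.deleteEdges (A.interiorEdges k)).Walk v w,
      ∀ u ∈ p.support, A.level u = k ∧ (A.Outward μ u → u = w) := by
  induction hw with
  | here _ => exact ⟨.nil, by simp [hv]⟩
  | step hn _ ih =>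
    rename_i v w _
    have hl : A.level (A.next v) = k := by rw [level_next, hv]
    obtain ⟨p, hp⟩ := ih hl
    refine ⟨.cons (deleteEdges_adj.2 ⟨A.adj_next v,
      not_mem_interiorEdges_of_level hv.ge hl.ge⟩) p, ?_⟩
    intro u hu
    rw [Walk.support_cons, List.mem_cons] at hu
    rcases hu with rfl | hu
    · exact ⟨hv, fun ho => absurd ho hn⟩
    · exact hp u hu

/-- By `3`-connectedness every boundary curve other than the outermost one has at least two rungs
leading outwards, if it has a rung leading inwards. -/
theorem not_firstHit_self [Finite V] (h : A.IsRung μ) (h3 : IsThreeConnected G) {a : V}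
    (ha : A.Outward μ a) (hl : 1 ≤ A.level a) :
    ¬ FirstHit A.next (A.Outward μ) (A.next a) a := by
  intro hf
  -- From every point of the curve the first outward vertex is `a`, so `a` is the only one.
  have hall : ∀ n : ℕ, FirstHit A.next (A.Outward μ) (A.next^[n] (A.next a)) a := by
    intro n
    induction n with
    | zero => exact hf
    | succ n ih =>
      rw [Function.iterate_succ_apply']
      generalize A.next^[n] (A.next a) = y at ih
      cases ih with
      | here _ => exact hf
      | step _ h => exact h
  have huniq : ∀ y, A.level y = A.level a → A.Outward μ y → y = a := by
    intro y hy ho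
    obtain ⟨n, hn⟩ := Equiv.Perm.SameCycle.exists_nat_pow_eq
      ((A.next_sameCycle (A.next a) y).2 (by rw [level_next, hy]))
    have := hall n
    rw [Equiv.Perm.iterate_eq_pow, hn] at this
    exact (FirstHit.here ho).unique this
  obtain ⟨y, hy, hyi⟩ := h.exists_inward hl (A.level_le a)
  -- Now `a` is a cut vertex: without it nothing joins the inward vertex `y` on its curve to `μ a`.
  have hconn := h3.2 {a} (by simp)
  have hya : y ≠ a := fun e => (h.inward_iff y).1 hyi (e ▸ ha)
  have hba : μ a ≠ a := (h.adj a).ne'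
  obtain ⟨p⟩ := hconn.preconnected ⟨y, by simpa using hya⟩ ⟨μ a, by simpa using hba⟩
  obtain ⟨d, -, h1, h2⟩ := p.exists_boundary_dart {v | A.level v ≤ A.level a}
    (by simp [hy]) (by simp only [Outward] at ha; simp [ha])
  simp only [Set.mem_ofPred_eq, not_le] at h1 h2
  obtain ⟨e, ho⟩ := h.eq_rung_of_level_lt (v := d.fst) (w := d.snd) d.adj (by omega)
  have ho' := ho
  rw [Outward, ← e] at ho'
  have := d.fst.2
  simp only [Finset.mem_singleton, Set.mem_ofPred_eq] at this
  exact this (huniq _ (by omega) ho)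

/-- Consecutive rungs leading outwards start at vertices of different colours. -/
theorem color_ne_of_firstHit_outward [Finite V] (h : A.IsRung μ)
    (hG : IsBarnette G) (hAC : A.IsAnnularConnected)
    {c : V → Bool} (hc : ∀ u v, G.Adj u v → c u ≠ c v) {a a' : V}
    (ha : A.Outward μ a) (haa : FirstHit A.next (A.Outward μ) (A.next a) a') : c a ≠ c a' := by
  rcases Nat.eq_zero_or_pos (A.level a) with h0 | hpos
  -- All rungs on `C_0` lead outwards, so `a'` is simply `next a`.
  · have := haa.unique (.here (h.outward_of_level_eq_zero (by rw [level_next, h0])))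
    rw [this]
    exact hc _ _ (A.adj_next a)
  have hne : a ≠ a' := by
    rintro rfl
    exact h.not_firstHit_self hG.threeConnected ha hpos haa
  have hax := level_lt_of_outward ha
  have hbip : (A.outerPart (A.level a)).IsBipartite := by
    obtain ⟨-, h2⟩ | ⟨-, h2⟩ | ⟨-, h2⟩ := hAC.2 (A.level a) hpos hax.le
    · exact h2.bipartite
    · exact h2.bipartite
    · obtain ⟨v, hv⟩ := A.level_surj x le_rfl
      have : v ∈ A.outerVerts (A.level a) := mem_outerVerts_of_lt (by omega)
      rw [h2] at this
      exact this.elim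
  obtain ⟨D, hD⟩ := exists_coloring_outerPart hbip
  have ha'l : A.level a' = A.level a := by rw [level_eq_of_firstHit haa, level_next]
  have ha' : a' ∈ A.outerVerts (A.level a) := by
    rw [← ha'l]
    exact h.mem_outerVerts_of_outward haa.prop
  -- Between `a` and `a'` there are only ends of inward rungs, which are dissolved, so `a` and `a'`
  -- are adjacent in the outer part.
  have hDa : D a ≠ D a' := by
    refine hD _ _ (h.mem_outerVerts_of_outward ha) ha' hne ?_
    obtain ⟨p, hp⟩ := exists_walk (A.level_next a) haa
    refine ⟨.cons (deleteEdges_adj.2 ⟨A.adj_next a,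
      not_mem_interiorEdges_of_level le_rfl (A.level_next a).ge⟩) p, ?_⟩
    intro u hu huo
    rw [Walk.support_cons, List.mem_cons] at hu
    rcases hu with rfl | hu
    · exact Or.inl rfl
    · obtain ⟨hl, ho⟩ := hp u hu
      rcases h.outward_or_inward u with hu' | hu'
      · exact Or.inr (ho hu')
      · exact absurd (hl ▸ h.mem_interiorEnds_of_inward hu') huo.2
  have hedge : ∀ u v, G.Adj u v → u ∈ A.outerVerts (A.level a) → v ∈ A.outerVerts (A.level a) →
      D u ≠ D v := fun u v huv hu hv => by
    refine hD u v hu hv huv.ne ⟨.cons (deleteEdges_adj.2 ⟨huv,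
      not_mem_interiorEdges_of_level hu.1 hv.1⟩) .nil, ?_⟩
    intro w hw _
    simpa using hw
  have hbl : A.level (μ a) = A.level a + 1 := ha
  obtain ⟨b, hb⟩ := h.exists_firstHit_inward (v := A.next (μ a)) (by rw [level_next]; omega)
  have hab : a' = μ b := haa.unique (h.firstHit_rung hG.cubic ha hb)
  have hb' : A.level b = A.level a + 1 := by rw [level_eq_of_firstHit hb, level_next, hbl]
  have hup : ∀ u, A.level u = A.level (A.next (μ a)) → u ∈ A.outerVerts (A.level a) :=
    fun u hu => mem_outerVerts_of_lt (by rw [hu, level_next]; omega)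
  -- On the next curve out nothing is dissolved, so `c` and `D` both alternate there, and both flip
  -- across rungs. Whether they agree is thus the same at `a` and at `a'`, and `hDa` carries over to
  -- `c`.
  have key := beq_of_firstHit (c := c) (c' := D) hb (fun u _ => hc _ _ (A.adj_next u))
    (fun u hu => hedge _ _ (A.adj_next u) (hup u hu) (hup _ (by rw [level_next, hu])))
  have e1 := hc _ _ (A.adj_next (μ a))
  have e2 := hedge _ _ (A.adj_next (μ a)) (mem_outerVerts_of_lt (by omega))
    (mem_outerVerts_of_lt (by rw [level_next]; omega))
  have e3 := hc _ _ (h.adj a)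
  have e4 := hedge _ _ (h.adj a) (h.mem_outerVerts_of_outward ha) (mem_outerVerts_of_lt (by omega))
  have e5 := hc _ _ (h.adj b)
  have e6 := hedge _ _ (h.adj b) (mem_outerVerts_of_lt (by omega)) (hab ▸ ha')
  rw [hab] at hDa ⊢
  revert key hDa e1 e2 e3 e4 e5 e6
  generalize c a = c1, c (μ a) = c2, c b = c3, c (μ b) = c4, c (A.next (μ a)) = c5,
    D a = d1, D (μ a) = d2, D b = d3, D (μ b) = d4, D (A.next (μ a)) = d5
  revert c1 c2 c3 c4 c5 d1 d2 d3 d4 d5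
  decide

/-- Consecutive rungs leading inwards start at vertices of different colours. -/
theorem color_ne_of_firstHit_inward [Finite V] (h : A.IsRung μ)
    (hG : IsBarnette G) (hAC : A.IsAnnularConnected)
    {c : V → Bool} (hc : ∀ u v, G.Adj u v → c u ≠ c v) {b b' : V}
    (hb : A.Inward μ b) (hbb : FirstHit A.next (A.Inward μ) (A.next b) b') : c b ≠ c b' := by
  -- The inner ends of the two rungs are consecutive too, and a rung flips the colour at both
  -- places.
  have hμ := (h.outward_rung b).2 hb
  have hf := h.firstHit_rung hG.cubic hμ (by rwa [h.invol])
  have := h.color_ne_of_firstHit_outward hG hAC hc hμ hf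
  have e1 := hc _ _ (h.adj b)
  have e2 := hc _ _ (h.adj b')
  revert this e1 e2
  cases c b <;> cases c b' <;> cases c (μ b) <;> cases c (μ b') <;> simp

end IsRung

end AnnularEmbedding

/-! ### Colours at changes of direction -/

namespace AnnularEmbedding

variable {V : Type*} {G : SimpleGraph V} {x : ℕ} {A : AnnularEmbedding G x} {μ : V → V}

/-- On each boundary curve, the vertices at which the direction of the rungs changes have the same
colour. -/
theorem IsRung.exists_color_switch [Finite V] (h : A.IsRung μ) {c : V → Bool}
    (hc : ∀ u v, G.Adj u v → c u ≠ c v)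
    (hO : ∀ a a', A.Outward μ a → FirstHit A.next (A.Outward μ) (A.next a) a' → c a ≠ c a')
    (hI : ∀ a a', A.Inward μ a → FirstHit A.next (A.Inward μ) (A.next a) a' → c a ≠ c a')
    (k : ℕ) :
    ∃ e, ∀ v, A.level v = k → (A.Outward μ v ↔ A.Inward μ (A.next v)) → c v = e := by
  by_cases hk : 1 ≤ k ∧ k < x
  swap
  -- On `C_0` and `C_x` the direction never changes, so any colour will do.
  · refine ⟨true, fun v hv hs => ?_⟩
    exfalso
    have hl := A.level_next v
    have hle := A.level_le v
    by_cases h0 : k = 0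
    · exact (h.inward_iff _).1 (hs.1 (h.outward_of_level_eq_zero (by omega)))
        (h.outward_of_level_eq_zero (by omega))
    · have h1 : ¬ A.Outward μ v := fun ho => by
        have := level_lt_of_outward ho
        omega
      have h2 : ¬ A.Outward μ (A.next v) := fun ho => by
        have := level_lt_of_outward ho
        omega
      exact h1 (hs.2 ((h.inward_iff _).2 h2))
  have hfO : ∀ v, ∃ w, A.level v = k → FirstHit A.next (A.Outward μ) v w := fun v => by
    by_cases hv : A.level v = k
    · obtain ⟨w, hw⟩ := h.exists_firstHit_outward (v := v) (by omega)
      exact ⟨w, fun _ => hw⟩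
    · exact ⟨v, fun e => absurd e hv⟩
  have hfI : ∀ v, ∃ w, A.level v = k → FirstHit A.next (A.Inward μ) v w := fun v => by
    by_cases hv : A.level v = k
    · obtain ⟨w, hw⟩ := h.exists_firstHit_inward (v := v) (by omega)
      exact ⟨w, fun _ => hw⟩
    · exact ⟨v, fun e => absurd e hv⟩
  choose f hf using hfO
  choose g hg using hfI
  have next_eq : ∀ {p : V → Prop} {v w w'}, ¬ p v → FirstHit A.next p v w →
      FirstHit A.next p (A.next v) w' → w' = w := fun hn hw hw' => by
    cases hw with
    | here h => exact absurd h hn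
    | step _ hw => exact hw'.unique hw
  have hlev : ∀ {v}, A.level v = k → A.level (A.next v) = k := fun hv => by rw [level_next, hv]
  have self_eq : ∀ {p : V → Prop} {v w}, p v → FirstHit A.next p v w → w = v :=
    fun hp hw => hw.unique (.here hp)
  -- `f v` and `g v` are the first outward and inward vertices from `v` on. A step along the curve
  -- flips `c v` and moves exactly one of them to its successor, flipping that colour too, so `J` is
  -- constant. At a change of direction `f v` and `g v` are `v` and `next v` in some order, whence
  -- `J v = !c v`.
  let J : V → Bool := fun v => (c (f v) == c (g v)) == c v
  have hJ : ∀ v, A.level v = k → J (A.next v) = J v := by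
    intro v hv
    have h1 := hc _ _ (A.adj_next v)
    rcases h.outward_or_inward v with ho | hi
    · have e1 := self_eq ho (hf v hv)
      have e2 := next_eq (fun hi => (h.inward_iff v).1 hi ho) (hg v hv) (hg _ (hlev hv))
      have e3 := hO v _ ho (hf _ (hlev hv))
      simp only [J, e1, e2]
      revert h1 e3
      cases c v <;> cases c (A.next v) <;> cases c (f (A.next v)) <;> cases c (g v) <;> simp
    · have e1 := self_eq hi (hg v hv)
      have e2 := next_eq ((h.inward_iff v).1 hi) (hf v hv) (hf _ (hlev hv))
      have e3 := hI v _ hi (hg _ (hlev hv))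
      simp only [J, e1, e2]
      revert h1 e3
      cases c v <;> cases c (A.next v) <;> cases c (f v) <;> cases c (g (A.next v)) <;> simp
  obtain ⟨v₀, hv₀⟩ := A.level_surj k hk.2.le
  refine ⟨!J v₀, fun v hv hs => ?_⟩
  have hJv : J v = J v₀ := by
    obtain ⟨n, rfl⟩ := Equiv.Perm.SameCycle.exists_nat_pow_eq
      ((A.next_sameCycle v₀ v).2 (by rw [hv₀, hv]))
    clear hs
    induction n with
    | zero => rfl
    | succ n ih =>
      rw [pow_succ', Equiv.Perm.mul_apply, level_next] at hv
      rw [pow_succ', Equiv.Perm.mul_apply, hJ _ hv, ih hv]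
  have h1 := hc _ _ (A.adj_next v)
  rw [← hJv]
  rcases h.outward_or_inward v with ho | hi
  · have e1 := self_eq ho (hf v hv)
    have e2 := next_eq (fun hi => (h.inward_iff v).1 hi ho) (hg v hv)
      (.here (hs.1 ho))
    simp only [J, e1, ← e2]
    revert h1
    cases c v <;> cases c (A.next v) <;> simp
  · have e1 := self_eq hi (hg v hv)
    have hn := (h.inward_iff v).1 hi
    have e2 := next_eq hn (hf v hv) (.here (by
      rw [hs, h.inward_iff, not_not] at hn
      exact hn))
    simp only [J, e1, ← e2]
    revert h1
    cases c v <;> cases c (A.next v) <;> simp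

/-- If the vertices with property `p` on a boundary curve alternate in colour, and those of one
colour are followed by another one, then those of the other colour are preceded by one. -/
theorem exists_prev_of_color [Finite V] {c : V → Bool} {e : Bool} {k : ℕ} {p : V → Prop}
    (hp : ∀ v, A.level v = k → p v → c v = e → p (A.next v))
    (halt : ∀ a a', p a → FirstHit A.next p (A.next a) a' → c a ≠ c a')
    {v : V} (hl : A.level v = k) (hv : p v) (hcv : c v ≠ e) :
    ∃ u, A.next u = v ∧ p u ∧ c u = e := by
  obtain ⟨u, hu, huv⟩ := FirstHit.exists_prev A.next hv
  have h1 := halt u v hu huv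
  have h2 : c u = e := by
    revert h1 hcv
    cases c u <;> cases c v <;> cases e <;> simp
  have h3 := hp u (by rw [← level_next, ← level_eq_of_firstHit huv, hl]) hu h2
  exact ⟨u, (huv.unique (.here h3)).symm, hu, h2⟩

/-! ### Inner cycles and surgery -/

/-- `H` is a Hamiltonian cycle of the part of `G` on the boundary curves `C_0, …, C_j`. -/
structure IsInnerCycle (A : AnnularEmbedding G x) (j : ℕ) (H : SimpleGraph V) : Prop where
  le : H ≤ G
  level_le : ∀ u v, H.Adj u v → A.level u ≤ j
  ncard : ∀ v, A.level v ≤ j → (H.neighborSet v).ncard = 2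
  reachable : ∀ u v, A.level u ≤ j → A.level v ≤ j → H.Reachable u v

/-- An inner cycle uses both edges of the boundary curve at the end of a rung leading out of its
part of the graph. -/
theorem IsInnerCycle.adj_iff (h : A.IsRung μ) {j : ℕ} {H : SimpleGraph V}
    (hH : A.IsInnerCycle j H) {v : V} (hv : A.level v = j) (ho : A.Outward μ v) (w : V) :
    H.Adj v w ↔ w = A.next v ∨ A.next w = v := by
  have hsub : H.neighborSet v ⊆ {A.next v, A.next.symm v} := by
    intro w hw
    have hw' : H.Adj v w := hw
    have h1 := hH.level_le _ _ hw'.symm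
    obtain e | e | e := h.eq_of_adj v w (hH.le hw')
    · exact Or.inl e
    · exact Or.inr (by rw [← e]; simp)
    · rw [e] at h1
      simp only [Outward] at ho
      omega
  have heq := Set.eq_of_subset_of_ncard_le hsub (by
    rw [hH.ncard v hv.le]
    exact Set.ncard_insert_le _ _ |>.trans (by simp)) (by simp)
  rw [← mem_neighborSet, heq, Set.mem_insert_iff, Set.mem_singleton_iff,
    Equiv.eq_symm_apply]

/-- The graph obtained from `H` by deleting the edges from `a` to `next a` for `a ∈ X`, adding the
rungs at their ends, and adding the edges of `C_{j+1}` other than those from `b` to `next b` for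
`b ∈ Y`. -/
def extend (A : AnnularEmbedding G x) {μ : V → V} (h : A.IsRung μ) (j : ℕ) (H : SimpleGraph V)
    (X Y : Set V) : SimpleGraph V where
  Adj u v := (H.Adj u v ∧ ¬ (u ∈ X ∧ v = A.next u) ∧ ¬ (v ∈ X ∧ u = A.next v)) ∨
    (v = μ u ∧ (u ∈ X ∨ A.next.symm u ∈ X ∨ v ∈ X ∨ A.next.symm v ∈ X)) ∨
    (A.level u = j + 1 ∧ ((v = A.next u ∧ u ∉ Y) ∨ (u = A.next v ∧ v ∉ Y)))
  symm := ⟨by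
    rintro u v (⟨h1, h2, h3⟩ | ⟨rfl, h1⟩ | ⟨h1, ⟨rfl, h2⟩ | ⟨rfl, h2⟩⟩)
    · exact Or.inl ⟨h1.symm, h3, h2⟩
    · exact Or.inr (Or.inl ⟨(h.invol u).symm, by tauto⟩)
    · exact Or.inr (Or.inr ⟨by rw [level_next, h1], Or.inr ⟨rfl, h2⟩⟩)
    · exact Or.inr (Or.inr ⟨by rw [← level_next, h1], Or.inl ⟨rfl, h2⟩⟩)⟩
  loopless := ⟨by
    rintro u (⟨h1, h2, h3⟩ | ⟨h0, h1⟩ | ⟨h1, ⟨h0, h2⟩ | ⟨h0, h2⟩⟩)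
    · exact H.irrefl h1
    · exact (h.adj u).ne h0
    · exact (A.adj_next u).ne h0
    · exact (A.adj_next u).ne h0⟩

/-- Conditions under which `extend` preserves degrees. -/
structure IsSurgery (A : AnnularEmbedding G x) (μ : V → V) (j : ℕ) (X Y : Set V) : Prop where
  inner : ∀ a ∈ X, A.level a = j ∧ A.Outward μ a ∧ A.Outward μ (A.next a) ∧ A.next a ∉ X
  outer : ∀ b ∈ Y, A.level b = j + 1 ∧ A.Inward μ b ∧ A.Inward μ (A.next b) ∧ A.next b ∉ Y
  iff : ∀ a, A.level a = j → A.Outward μ a →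
    (a ∈ X ∨ A.next.symm a ∈ X ↔ μ a ∈ Y ∨ A.next.symm (μ a) ∈ Y)

theorem extend_le (h : A.IsRung μ) {j : ℕ} {H : SimpleGraph V} (hH : H ≤ G) (X Y : Set V) :
    A.extend h j H X Y ≤ G := by
  rintro u v (⟨h1, h2, h3⟩ | ⟨rfl, h1⟩ | ⟨h1, ⟨rfl, h2⟩ | ⟨rfl, h2⟩⟩)
  · exact hH h1
  · exact h.adj u
  · exact A.adj_next u
  · exact (A.adj_next v).symm

end AnnularEmbedding

namespace AnnularEmbedding

variable {V : Type*} {G : SimpleGraph V} {x : ℕ} {A : AnnularEmbedding G x} {μ : V → V}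

theorem extend_level_le (h : A.IsRung μ) {j : ℕ} {H : SimpleGraph V} (hH : A.IsInnerCycle j H)
    {X Y : Set V} (hS : A.IsSurgery μ j X Y) {u v : V} (huv : (A.extend h j H X Y).Adj u v) :
    A.level u ≤ j + 1 := by
  have hX : ∀ {a}, a ∈ X → A.level a = j ∧ A.level (μ a) = j + 1 ∧
      A.level (A.next a) = j ∧ A.level (μ (A.next a)) = j + 1 := fun {a} ha => by
    obtain ⟨h1, h2, h3, -⟩ := hS.inner a ha
    have := A.level_next a
    simp only [Outward] at h2 h3
    omega
  rcases huv with ⟨h1, h2, h3⟩ | ⟨rfl, h1⟩ | ⟨h1, -⟩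
  · exact (hH.level_le _ _ h1).trans (Nat.le_succ _)
  · rcases h1 with h1 | h1 | h1 | h1
    · have := hX h1; omega
    · have := hX h1; rw [Equiv.apply_symm_apply] at this; omega
    · have := hX h1; rw [h.invol] at this; omega
    · have := hX h1; rw [Equiv.apply_symm_apply, h.invol] at this; omega
  · exact h1.le

/-- No two deleted edges are consecutive, so an end of one loses exactly one edge, which `H` did
contain by `adj_iff`, and gains its rung. Other vertices keep their neighbours. -/
theorem ncard_neighborSet_extend_of_le (h : A.IsRung μ) {j : ℕ} {H : SimpleGraph V}
    (hH : A.IsInnerCycle j H) {X Y : Set V} (hS : A.IsSurgery μ j X Y) {v : V}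
    (hv : A.level v ≤ j) : ((A.extend h j H X Y).neighborSet v).ncard = 2 := by
  obtain ⟨p, rfl⟩ := A.next.surjective v
  have hnn : A.next (A.next p) ≠ p := A.next_next_ne p
  have hX : ∀ a, a ∈ X → A.level a = j ∧ A.Outward μ a ∧ A.next a ∉ X :=
    fun a ha => ⟨(hS.inner a ha).1, (hS.inner a ha).2.1, (hS.inner a ha).2.2.2⟩
  have hlow : ∀ w, A.level w ≤ j → w ∈ X ∨ A.next.symm w ∈ X → A.level w = j := fun w hw hx => by
    rcases hx with hx | hx
    · exact (hX _ hx).1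
    · rw [← A.level_next_symm]; exact (hX _ hx).1
  have hinj : ∀ {u v}, A.next u = A.next v → u = v := fun e => A.next.injective e
  by_cases h1 : A.next p ∈ X
  · have hp : p ∉ X := fun hp => (hX _ hp).2.2 h1
    have hadj := hH.adj_iff h (hX _ h1).1 (hX _ h1).2.1
    have : (A.extend h j H X Y).neighborSet (A.next p) = {p, μ (A.next p)} := by
      ext w
      simp only [mem_neighborSet, extend, hadj, h1, true_and, Equiv.symm_apply_apply, true_or,
        and_true, Set.mem_insert_iff, Set.mem_singleton_iff]
      constructor
      · rintro (⟨e | e, e', -⟩ | e | ⟨e, -⟩)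
        · exact absurd e e'
        · exact Or.inl (hinj e)
        · exact Or.inr e
        · omega
      · rintro (rfl | e)
        · exact Or.inl ⟨Or.inr rfl, hnn.symm, fun e => hp e.1⟩
        · exact Or.inr (Or.inl e)
    rw [this, Set.ncard_pair]
    intro e
    exact h.next_ne (A.next p) (by rw [← e])
  · by_cases h2 : p ∈ X
    · have ho := (hS.inner p h2).2.2.1
      have hadj := hH.adj_iff h (v := A.next p) (by rw [level_next]; exact (hX _ h2).1) ho
      have : (A.extend h j H X Y).neighborSet (A.next p) =
          {A.next (A.next p), μ (A.next p)} := by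
        ext w
        simp only [mem_neighborSet, extend, hadj, h1, h2, false_and, not_false_eq_true,
          true_and, Equiv.symm_apply_apply, true_or, or_true,
          and_true, Set.mem_insert_iff, Set.mem_singleton_iff]
        constructor
        · rintro (⟨e | e, e'⟩ | e | ⟨e, -⟩)
          · exact Or.inl e
          · exact absurd ⟨hinj e ▸ h2, e.symm⟩ e'
          · exact Or.inr e
          · omega
        · rintro (rfl | e)
          · refine Or.inl ⟨Or.inl rfl, fun e => hnn (hinj e.2).symm⟩
          · exact Or.inr (Or.inl e)
      rw [this, Set.ncard_pair]
      exact (h.ne_next _).symm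
    · have : (A.extend h j H X Y).neighborSet (A.next p) = H.neighborSet (A.next p) := by
        ext w
        simp only [mem_neighborSet, extend, h1, false_and, not_false_eq_true,
          true_and, Equiv.symm_apply_apply, h2, false_or]
        constructor
        · rintro (⟨e, -⟩ | ⟨rfl, e⟩ | ⟨e, -⟩)
          · exact e
          · exfalso
            have hμ : A.level (μ (A.next p)) = j ∧ A.Outward μ (μ (A.next p)) := by
              rcases e with e | e
              · exact ⟨(hX _ e).1, (hX _ e).2.1⟩
              · have h3 := (hS.inner _ e).2.2.1
                rw [Equiv.apply_symm_apply] at h3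
                exact ⟨by rw [← A.level_next_symm]; exact (hX _ e).1, h3⟩
            have h3 := hμ.2
            rw [Outward, h.invol] at h3
            omega
          · omega
        · exact fun e => Or.inl ⟨e, fun e' => h2 (hinj e'.2 ▸ e'.1)⟩
      rw [this]
      exact hH.ncard _ hv

/-- `H` does not reach this curve, and by `IsSurgery.iff` the rung is present exactly when one of
the two curve edges is missing. -/
theorem ncard_neighborSet_extend_of_eq (h : A.IsRung μ) {j : ℕ} {H : SimpleGraph V}
    (hH : A.IsInnerCycle j H) {X Y : Set V} (hS : A.IsSurgery μ j X Y) {v : V}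
    (hv : A.level v = j + 1) : ((A.extend h j H X Y).neighborSet v).ncard = 2 := by
  obtain ⟨p, rfl⟩ := A.next.surjective v
  have hnn : A.next (A.next p) ≠ p := A.next_next_ne p
  have hinj : ∀ {u v}, A.next u = A.next v → u = v := fun e => A.next.injective e
  have hXl : ∀ a, a ∈ X ∨ A.next.symm a ∈ X → A.level a = j ∧ A.Outward μ a := by
    rintro a (ha | ha)
    · exact ⟨(hS.inner a ha).1, (hS.inner a ha).2.1⟩
    · have h1 := hS.inner _ ha
      rw [Equiv.apply_symm_apply, level_next_symm] at h1
      exact ⟨h1.1, h1.2.2.1⟩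
  have hnX : ∀ a, A.level a = j + 1 → ¬ (a ∈ X ∨ A.next.symm a ∈ X) := fun a ha h1 => by
    have := (hXl a h1).1
    omega
  have hrung : (μ (A.next p) ∈ X ∨ A.next.symm (μ (A.next p)) ∈ X) ↔ (A.next p ∈ Y ∨ p ∈ Y) := by
    constructor
    · intro h1
      have := (hS.iff _ (hXl _ h1).1 (hXl _ h1).2).1 h1
      rwa [h.invol, Equiv.symm_apply_apply] at this
    · intro h1
      have hi : A.Inward μ (A.next p) := by
        rcases h1 with h1 | h1
        · exact (hS.outer _ h1).2.1
        · exact (hS.outer _ h1).2.2.1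
      refine (hS.iff _ ?_ ((h.outward_rung _).2 hi)).2 ?_
      · simp only [Inward] at hi
        omega
      · rwa [h.invol, Equiv.symm_apply_apply]
  have hH' : ∀ w, ¬ H.Adj (A.next p) w := fun w hw => by
    have := hH.level_le _ _ hw
    omega
  have hnp := hnX _ hv
  rw [not_or] at hnp
  have hadj : ∀ w, (A.extend h j H X Y).Adj (A.next p) w ↔
      (w = μ (A.next p) ∧ (A.next p ∈ Y ∨ p ∈ Y)) ∨ (w = A.next (A.next p) ∧ A.next p ∉ Y) ∨
        (w = p ∧ p ∉ Y) := by
    intro w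
    simp only [extend, hH', false_and, false_or, hv, true_and, hnp]
    rw [← hrung]
    constructor
    · rintro (⟨rfl, e⟩ | e | ⟨e, e'⟩)
      · exact Or.inl ⟨rfl, e⟩
      · exact Or.inr (Or.inl e)
      · exact Or.inr (Or.inr ⟨(hinj e).symm, by rwa [hinj e]⟩)
    · rintro (⟨rfl, e⟩ | e | ⟨rfl, e'⟩)
      · exact Or.inl ⟨rfl, e⟩
      · exact Or.inr (Or.inl e)
      · exact Or.inr (Or.inr ⟨rfl, e'⟩)
  have hset : (A.extend h j H X Y).neighborSet (A.next p) =
      {w | (w = μ (A.next p) ∧ (A.next p ∈ Y ∨ p ∈ Y)) ∨ (w = A.next (A.next p) ∧ A.next p ∉ Y) ∨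
        (w = p ∧ p ∉ Y)} := Set.ext hadj
  rw [hset]
  by_cases h1 : A.next p ∈ Y
  · have h2 : p ∉ Y := fun h2 => (hS.outer p h2).2.2.2 h1
    simp only [h1, h2, or_false, and_true, not_true, not_false_eq_true, and_false, false_or]
    refine Set.ncard_pair (a := μ (A.next p)) (b := p) fun e => ?_
    exact h.next_ne (A.next p) (by rw [e])
  · by_cases h2 : p ∈ Y
    · simp only [h1, h2, or_true, and_true, not_true, not_false_eq_true, and_false, or_false]
      exact Set.ncard_pair (h.ne_next _)
    · simp only [h1, h2, or_self, and_true, not_false_eq_true, and_false, false_or]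
      exact Set.ncard_pair hnn

/-- The surgery gives an inner cycle as soon as the deleted edges are bypassed and the new boundary
curve is attached. -/
theorem isInnerCycle_extend (h : A.IsRung μ) {j : ℕ} {H : SimpleGraph V}
    (hH : A.IsInnerCycle j H) {X Y : Set V} (hS : A.IsSurgery μ j X Y)
    (hbypass : ∀ a ∈ X, (A.extend h j H X Y).Reachable a (A.next a))
    (hattach : ∀ v, A.level v = j + 1 →
      ∃ u, A.level u ≤ j ∧ (A.extend h j H X Y).Reachable v u) :
    A.IsInnerCycle (j + 1) (A.extend h j H X Y) where
  le := extend_le h hH.le X Y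
  level_le _ _ huv := extend_level_le h hH hS huv
  ncard v hv := by
    rcases hv.lt_or_eq with hv | hv
    · exact ncard_neighborSet_extend_of_le h hH hS (by omega)
    · exact ncard_neighborSet_extend_of_eq h hH hS hv
  reachable u v hu hv := by
    -- An edge of `H` either survives or is replaced by its bypass, so reachability in `H` persists.
    have hadj : ∀ u v, H.Adj u v → (A.extend h j H X Y).Reachable u v := by
      intro u v huv
      by_cases h1 : u ∈ X ∧ v = A.next u
      · rw [h1.2]; exact hbypass u h1.1
      · by_cases h2 : v ∈ X ∧ u = A.next v
        · rw [h2.2]; exact (hbypass v h2.1).symm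
        · exact Adj.reachable (Or.inl ⟨huv, h1, h2⟩)
    have hreach : ∀ u v, H.Reachable u v → (A.extend h j H X Y).Reachable u v := by
      rintro u v ⟨p⟩
      induction p with
      | nil => exact Reachable.refl _
      | cons e _ ih => exact (hadj _ _ e).trans ih
    have hdown : ∀ v, A.level v ≤ j + 1 →
        ∃ u, A.level u ≤ j ∧ (A.extend h j H X Y).Reachable v u := by
      intro v hv
      rcases hv.lt_or_eq with hv | hv
      · exact ⟨v, by omega, Reachable.refl _⟩
      · exact hattach v hv
    obtain ⟨u', hu', hu⟩ := hdown u hu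
    obtain ⟨v', hv', hv⟩ := hdown v hv
    exact (hu.trans (hreach _ _ (hH.reachable _ _ hu' hv'))).trans hv.symm

end AnnularEmbedding

/-! ### The two surgeries and the induction step -/

namespace AnnularEmbedding

variable {V : Type*} {G : SimpleGraph V} {x : ℕ} {A : AnnularEmbedding G x} {μ : V → V}

/-- If consecutive rungs start at neighbours `a`, `next a` and end at neighbours, then an inner
cycle can be led along these two rungs and once around the next boundary curve. -/
theorem IsInnerCycle.extend_around [Finite V] (h : A.IsRung μ) {j : ℕ} {H : SimpleGraph V}
    (hH : A.IsInnerCycle j H) {a : V} (hl : A.level a = j) (ha : A.Outward μ a)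
    (hna : A.Outward μ (A.next a)) (hμ : μ (A.next a) = A.next (μ a)) :
    A.IsInnerCycle (j + 1) (A.extend h j H {a} {μ a}) := by
  have hb : A.level (μ a) = j + 1 := by rw [← hl]; exact ha
  have hS : A.IsSurgery μ j {a} {μ a} :=
    { inner := by
        rintro _ rfl
        exact ⟨hl, ha, hna, (A.adj_next _).ne'⟩
      outer := by
        rintro _ rfl
        refine ⟨hb, (h.inward_rung a).2 ha, ?_, (A.adj_next _).ne'⟩
        rw [← hμ]
        exact (h.inward_rung _).2 hna
      iff := by
        intro a' _ _
        simp only [Set.mem_singleton_iff, Equiv.symm_apply_eq]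
        rw [← hμ, (Function.Involutive.injective h.invol).eq_iff,
          (Function.Involutive.injective h.invol).eq_iff] }
  have hcirc : ∀ v, A.level v = j + 1 →
      (A.extend h j H {a} {μ a}).Reachable (A.next (μ a)) v := by
    intro v hv
    obtain ⟨n, rfl⟩ := Equiv.Perm.SameCycle.exists_nat_pow_eq
      ((A.next_sameCycle (A.next (μ a)) v).2 (by rw [level_next, hb, hv]))
    induction n with
    | zero => exact Reachable.refl _
    | succ n ih =>
      rw [pow_succ', Equiv.Perm.mul_apply, level_next] at hv
      rw [pow_succ', Equiv.Perm.mul_apply]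
      -- The only missing curve edge starts at `μ a` and leads back to the base point `next (μ a)`.
      by_cases e : (A.next ^ n) (A.next (μ a)) = μ a
      · rw [e]
      · exact (ih hv).trans (Adj.reachable (Or.inr (Or.inr ⟨hv, Or.inl ⟨rfl, e⟩⟩)))
  have hrung : (A.extend h j H {a} {μ a}).Adj (A.next (μ a)) (A.next a) := by
    refine Or.inr (Or.inl ⟨?_, by simp⟩)
    rw [← hμ, h.invol]
  refine isInnerCycle_extend h hH hS ?_ fun v hv =>
    ⟨A.next a, by rw [level_next, hl], (hcirc v hv).symm.trans hrung.reachable⟩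
  intro a' ha'
  rw [Set.mem_singleton_iff.1 ha']
  have h1 : (A.extend h j H {a} {μ a}).Adj a (μ a) := Or.inr (Or.inl ⟨rfl, by simp⟩)
  exact h1.reachable.trans ((hcirc _ hb).symm.trans hrung.reachable)

/-- The alternating surgery: an inner cycle is led outwards along every rung. -/
theorem IsInnerCycle.extend_alternating [Finite V] (h : A.IsRung μ)
    (hcub : ∀ v, (G.neighborSet v).ncard = 3) {c : V → Bool}
    (hc : ∀ u v, G.Adj u v → c u ≠ c v)
    (hO : ∀ a a', A.Outward μ a → FirstHit A.next (A.Outward μ) (A.next a) a' → c a ≠ c a')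
    (hI : ∀ a a', A.Inward μ a → FirstHit A.next (A.Inward μ) (A.next a) a' → c a ≠ c a')
    {j : ℕ} {H : SimpleGraph V} (hH : A.IsInnerCycle j H) {e : Bool}
    (h1 : ∀ v, A.level v = j → A.Outward μ v → c v = e → A.Outward μ (A.next v))
    (h2 : ∀ v, A.level v = j + 1 → A.Inward μ v → c v = e → A.Inward μ (A.next v)) :
    A.IsInnerCycle (j + 1) (A.extend h j H {a | A.level a = j ∧ A.Outward μ a ∧ c a = e}
      {b | A.level b = j + 1 ∧ A.Inward μ b ∧ c b = e}) := by
  have hnext : ∀ v, c v = e → c (A.next v) ≠ e := fun v hv e' =>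
    hc _ _ (A.adj_next v) (hv.trans e'.symm)
  -- By alternation and `h1`, the outward vertices on `C_j` are exactly the ends of the edges to be
  -- deleted, so every rung of the annulus gets used.
  have hallX : ∀ a, A.level a = j → A.Outward μ a →
      (A.level a = j ∧ A.Outward μ a ∧ c a = e) ∨
      (A.level (A.next.symm a) = j ∧ A.Outward μ (A.next.symm a) ∧ c (A.next.symm a) = e) := by
    intro a hl ho
    by_cases hca : c a = e
    · exact Or.inl ⟨hl, ho, hca⟩
    · obtain ⟨u, rfl, hu, hcu⟩ := exists_prev_of_color h1 hO hl ho hca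
      rw [Equiv.symm_apply_apply]
      exact Or.inr ⟨by rw [← hl, level_next], hu, hcu⟩
  have hallY : ∀ b, A.level b = j + 1 → A.Inward μ b →
      (A.level b = j + 1 ∧ A.Inward μ b ∧ c b = e) ∨
      (A.level (A.next.symm b) = j + 1 ∧ A.Inward μ (A.next.symm b) ∧
        c (A.next.symm b) = e) := by
    intro b hl hi
    by_cases hcb : c b = e
    · exact Or.inl ⟨hl, hi, hcb⟩
    · obtain ⟨u, rfl, hu, hcu⟩ := exists_prev_of_color h2 hI hl hi hcb
      rw [Equiv.symm_apply_apply]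
      exact Or.inr ⟨by rw [← hl, level_next], hu, hcu⟩
  have hup : ∀ {a}, A.level a = j → A.Outward μ a → A.level (μ a) = j + 1 := fun hl ho => by
    rw [← hl]; exact ho
  have hS : A.IsSurgery μ j {a | A.level a = j ∧ A.Outward μ a ∧ c a = e}
      {b | A.level b = j + 1 ∧ A.Inward μ b ∧ c b = e} :=
    { inner := fun a ⟨hl, ho, hca⟩ => ⟨hl, ho, h1 a hl ho hca, fun h' => hnext a hca h'.2.2⟩
      outer := fun b ⟨hl, hi, hcb⟩ => ⟨hl, hi, h2 b hl hi hcb, fun h' => hnext b hcb h'.2.2⟩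
      iff := fun a hl ho => ⟨fun _ => hallY _ (hup hl ho) ((h.inward_rung a).2 ho),
        fun _ => hallX a hl ho⟩ }
  generalize hXe : {a | A.level a = j ∧ A.Outward μ a ∧ c a = e} = X at *
  generalize hYe : {b | A.level b = j + 1 ∧ A.Inward μ b ∧ c b = e} = Y at *
  have hrung : ∀ a, A.level a = j → A.Outward μ a → (A.extend h j H X Y).Adj a (μ a) :=
    fun a hl ho => by
      refine Or.inr (Or.inl ⟨rfl, ?_⟩)
      subst hXe
      rcases hallX a hl ho with h' | h'
      · exact Or.inl h'
      · exact Or.inr (Or.inl h')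
  have harc : ∀ v w, A.level v = j + 1 → FirstHit A.next (A.Inward μ) v w →
      (A.extend h j H X Y).Reachable v w := by
    intro v w hv hw
    induction hw with
    | here _ => exact Reachable.refl _
    | step hn _ ih =>
      refine Reachable.trans (Adj.reachable ?_) (ih (by rw [level_next, hv]))
      exact Or.inr (Or.inr ⟨hv, Or.inl ⟨rfl, fun hY => hn (hS.outer _ hY).2.1⟩⟩)
  refine isInnerCycle_extend h hH hS ?_ ?_
  · intro a ha
    obtain ⟨hl, ho, hno, -⟩ := hS.inner a ha
    obtain ⟨b, hb⟩ := h.exists_firstHit_inward (v := A.next (μ a))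
      (by rw [level_next, hup hl ho]; omega)
    have hba : μ b = A.next a := (h.firstHit_rung hcub ho hb).unique (.here hno)
    have hbn : b = μ (A.next a) := by rw [← hba, h.invol]
    -- A rung flips the colour, so `μ a` is not in `Y`: the edge after it stays, and with it the
    -- whole arc to `μ (next a)`, which bypasses the edge from `a` to `next a`.
    have hedge : (A.extend h j H X Y).Adj (μ a) (A.next (μ a)) := by
      refine Or.inr (Or.inr ⟨hup hl ho, Or.inl ⟨rfl, fun hY => ?_⟩⟩)
      subst hXe hYe
      exact hc _ _ (h.adj a) (ha.2.2.trans hY.2.2.symm)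
    have h3 := harc _ _ (by rw [level_next, hup hl ho]) hb
    rw [hbn] at h3
    exact (hrung a hl ho).reachable.trans (hedge.reachable.trans
      (h3.trans (hrung _ (by rw [level_next, hl]) hno).symm.reachable))
  · intro v hv
    obtain ⟨b, hb⟩ := h.exists_firstHit_inward (v := v) (by omega)
    have hbl : A.level b = j + 1 := by rw [level_eq_of_firstHit hb, hv]
    have hbi : A.level (μ b) + 1 = A.level b := hb.prop
    have h3 := hrung (μ b) (by omega) ((h.outward_rung b).2 hb.prop)
    rw [h.invol] at h3
    exact ⟨μ b, by omega, (harc v b hv hb).trans h3.symm.reachable⟩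

/-- The innermost boundary curve is an inner cycle. -/
theorem exists_isInnerCycle_zero [Finite V] (A : AnnularEmbedding G x) :
    ∃ H, A.IsInnerCycle 0 H := by
  let H : SimpleGraph V :=
    { Adj := fun u v => A.level u = 0 ∧ (v = A.next u ∨ u = A.next v)
      symm := ⟨by
        rintro u v ⟨h, rfl | rfl⟩
        · exact ⟨by rw [level_next, h], Or.inr rfl⟩
        · exact ⟨by rw [← level_next, h], Or.inl rfl⟩⟩
      loopless := ⟨by
        rintro u ⟨-, e | e⟩ <;> exact (A.adj_next u).ne e⟩ }
  refine ⟨H, ?_, ?_, ?_, ?_⟩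
  · rintro u v ⟨-, rfl | rfl⟩
    · exact A.adj_next u
    · exact (A.adj_next v).symm
  · exact fun u v h => h.1.le
  · intro v hv
    have : H.neighborSet v = {A.next v, A.next.symm v} := by
      ext w
      simp only [mem_neighborSet, H, Set.mem_insert_iff, Set.mem_singleton_iff,
        Equiv.eq_symm_apply]
      constructor
      · rintro ⟨-, e | e⟩
        · exact Or.inl e
        · exact Or.inr e.symm
      · rintro (e | e)
        · exact ⟨by omega, Or.inl e⟩
        · exact ⟨by omega, Or.inr e.symm⟩
    rw [this, Set.ncard_pair]
    rw [Ne, Equiv.eq_symm_apply]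
    exact A.next_next_ne v
  · intro u v hu hv
    obtain ⟨n, rfl⟩ := Equiv.Perm.SameCycle.exists_nat_pow_eq
      ((A.next_sameCycle u v).2 (by omega))
    induction n with
    | zero => exact Reachable.refl _
    | succ n ih =>
      rw [pow_succ', Equiv.Perm.mul_apply, level_next] at hv
      rw [pow_succ', Equiv.Perm.mul_apply]
      exact (ih hv).trans (Adj.reachable ⟨by omega, Or.inl rfl⟩)

/-- With `e` and `d` the colours of the direction changes on `C_j` and `C_{j+1}`, vertices coloured
`!e` and `!d` respectively start the pairs. Which surgery applies depends on whether `d = e`. -/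
theorem exists_isInnerCycle_succ [Finite V] (h : A.IsRung μ) (hG : IsBarnette G)
    (hAC : A.IsAnnularConnected) {j : ℕ} (hj : j < x) (hH : ∃ H, A.IsInnerCycle j H) :
    ∃ H, A.IsInnerCycle (j + 1) H := by
  obtain ⟨H, hH⟩ := hH
  obtain ⟨c, hc⟩ := hG.bipartite.exists_bool
  have hO : ∀ a a', A.Outward μ a → FirstHit A.next (A.Outward μ) (A.next a) a' → c a ≠ c a' :=
    fun a a' ha haa => h.color_ne_of_firstHit_outward hG hAC hc ha haa
  have hI : ∀ a a', A.Inward μ a → FirstHit A.next (A.Inward μ) (A.next a) a' → c a ≠ c a' :=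
    fun a a' ha haa => h.color_ne_of_firstHit_inward hG hAC hc ha haa
  obtain ⟨e, he⟩ := h.exists_color_switch hc hO hI j
  obtain ⟨d, hd⟩ := h.exists_color_switch hc hO hI (j + 1)
  have h1 : ∀ v, A.level v = j → A.Outward μ v → c v = !e → A.Outward μ (A.next v) := by
    intro v hv ho hcv
    by_contra hn
    have := he v hv ⟨fun _ => (h.inward_iff _).2 hn, fun _ => ho⟩
    simp [this] at hcv
  have h2 : ∀ v, A.level v = j + 1 → A.Inward μ v → c v = !d → A.Inward μ (A.next v) := by
    intro v hv hi hcv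
    by_contra hn
    have := hd v hv ⟨fun ho => absurd ho ((h.inward_iff _).1 hi), fun hi => absurd hi hn⟩
    simp [this] at hcv
  by_cases hed : d = e
  · subst hed
    exact ⟨_, hH.extend_alternating h hG.cubic hc hO hI h1 h2⟩
  · obtain ⟨a, hl, ho, hca⟩ : ∃ a, A.level a = j ∧ A.Outward μ a ∧ c a = !e := by
      obtain ⟨a, hl, ho⟩ := h.exists_outward hj
      by_cases hca : c a = !e
      · exact ⟨a, hl, ho, hca⟩
      · obtain ⟨a', ha'⟩ := h.exists_firstHit_outward (v := A.next a) (by rw [level_next]; omega)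
        refine ⟨a', by rw [level_eq_of_firstHit ha', level_next, hl], ha'.prop, ?_⟩
        have := hO a a' ho ha'
        revert this hca
        cases c a <;> cases c a' <;> cases e <;> simp
    have hno := h1 a hl ho hca
    have hμl : A.level (μ a) = j + 1 := by rw [← hl]; exact ho
    -- Since `d ≠ e` and `μ a` has the colour opposite to `a`, that colour is `!d`. Hence `next (μ
    -- a)` is inward, and by the cyclic order it is the end of the rung at `next a`.
    have hi := h2 (μ a) hμl ((h.inward_rung a).2 ho) (by
      have := hc _ _ (h.adj a)
      revert this hca hed
      cases c a <;> cases c (μ a) <;> cases e <;> cases d <;> simp)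
    have hμ := (h.firstHit_rung hG.cubic ho (.here hi)).unique (.here hno)
    exact ⟨_, hH.extend_around h hl ho hno (by rw [← hμ, h.invol])⟩

end AnnularEmbedding

/-! ### From a spanning cycle to Hamiltonicity -/

/-- A finite graph with a connected spanning `2`-regular subgraph is Hamiltonian. -/
theorem SimpleGraph.isHamiltonian_of_two_regular {V : Type*} [Fintype V] [DecidableEq V]
    {G H : SimpleGraph V} (hle : H ≤ G) (hH : H.Connected)
    (hdeg : ∀ v, (H.neighborSet v).ncard = 2) : G.IsHamiltonian := by
  refine IsHamiltonian.mono hle fun _ => ?_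
  obtain ⟨v⟩ := hH.nonempty
  -- In a `2`-regular graph some cycle covers the component of `v`, which here is everything.
  obtain ⟨p, hp, hverts⟩ := IsCycles.exists_cycle_toSubgraph_verts_eq_connectedComponentSupp
    (G := H) (c := H.connectedComponentMk v) (v := v) (fun v _ => hdeg v) rfl
    (Set.nonempty_of_ncard_ne_zero (by rw [hdeg]; omega))
  refine ⟨v, p, Walk.isHamiltonianCycle_iff_isCycle_and_support_count_tail_eq_one.2
    ⟨hp, fun a => List.count_eq_one_of_mem hp.support_nodup ?_⟩⟩
  have ha : a ∈ p.support := by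
    rw [← Walk.mem_verts_toSubgraph, hverts, ConnectedComponent.mem_supp_iff,
      ConnectedComponent.eq]
    exact hH.preconnected a v
  rw [← Walk.cons_tail_support, List.mem_cons] at ha
  rcases ha with rfl | ha
  · exact Walk.end_mem_tail_support hp.not_nil
  · exact ha

theorem mainTheorem1 {V : Type*} [Fintype V] [DecidableEq V] (G : SimpleGraph V)
    (hG : IsBarnette G) (x : ℕ) (A : AnnularEmbedding G x) (hAC : A.IsAnnularConnected)
    (hA : A.HasNonsingularRingRuns) : G.IsHamiltonian := by
  obtain ⟨μ, h⟩ := A.exists_isRung hG.cubic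
  have key : ∀ j ≤ x, ∃ H, A.IsInnerCycle j H := by
    intro j
    induction j with
    | zero => exact fun _ => A.exists_isInnerCycle_zero
    | succ j ih =>
      exact fun hj => AnnularEmbedding.exists_isInnerCycle_succ h hG hAC hj (ih (by omega))
  obtain ⟨H, hH⟩ := key x le_rfl
  have := A.connected.nonempty
  exact SimpleGraph.isHamiltonian_of_two_regular hH.le
    ⟨fun u v => hH.reachable u v (A.level_le u) (A.level_le v)⟩
    fun v => hH.ncard v (A.level_le v)
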